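/- Let $\mathbb V$ be one of the real linear spaces $\mathbb R^{n_1\times n_2}$, $\mathbb C^{n_1\times n_2}$ (put $n=\min(n_1,n_2)$), or the space $\mathbb S^n$ of real symmetric or complex Hermitian $n\times n$ matrices ($n_1=n_2=n$), of fixed size, with inner product $\langle X,Y\rangle=\mathrm{Re}\,\mathrm{Tr}(X^{*}Y)$ (where $X^*$ is the conjugate transpose) and induced norm $\|\cdot\|_F$. Let $\Theta_1,\dots,\Theta_d$ be an orthonormal basis of $\mathbb V$, let $\overline X\in\mathbb V$, let $\alpha\subseteq\{1,\dots,d\}$ with complement $\beta$, and let $$y_i=\langle\Theta_{\omega_i},\overline X\rangle+\nu\xi_i,\qquad i=1,2,\dots,$$ where $\nu>0$; the indices $\omega_i$ are i.i.d. with $\Pr(\omega_i=k)=0$ for $k\in\alpha$ and $\Pr(\omega_i=k)=p_k>0$ for $k\in\beta$; the real noises $\xi_i$ are i.i.d. with $\mathbb E\,\xi_i=0$, $\mathbb E\,\xi_i^2=1$; and the sequences $(\omega_i)$ and $(\xi_i)$ are independent. Let $f:\mathbb R^n\to\mathbb R^n$ satisfy $f(Qx)=Qf(x)$ for all $x$ and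 all signed permutation matrices $Q$, and let $F:\mathbb V\to\mathbb V$ be the associated spectral operator $F(X)=U\,\mathrm{Diag}(f(\sigma(X)))\,W^{*}$, where $\sigma(X)$ is the vector of singular values of $X$ in nonincreasing order and $X=U\,\mathrm{Diag}(\sigma(X))\,W^{*}$ is any singular value decomposition. Assume that $F$ is continuous at $\overline X$. Let $\widetilde X_m$ be random matrices in $\mathbb V$ with $\widetilde X_m\to\overline X$ in probability as $m\to\infty$. Let $\rho_m>0$ be deterministic with $\rho_m\to0$, and let $\gamma_m\ge0$ be random with $\gamma_m=O_p(1)$ (bounded in probability). (i) For $m\ge1$ let $\widehat X_m$ be an optimal solution (almost surely, whenever one exists; otherwise arbitrary, and any one if there are several) of $$\min_{X\in\mathbb V}\ \frac1{2m}\sum_{i=1}^m\big(y_i-\langle\Theta_{\omega_i},X\rangle\big)^2+\rho_m\Big(\|X\|_*-\langle F(\widetilde X_m),X\rangle+\frac{\gamma_m}2\|X-\widetilde X_m\|_F^2\Big)\quad\text{s.t. }\langle\Theta_k,X\rangle=\langle\Theta_k,\overline X\rangle\ \ \forall k\in\alpha,$$ where $\|\cdot\|_*$ is the nuclear norm. Then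 $\widehat X_m\to\overline X$ in probability as $m\to\infty$. (ii) Let $\mathbb V=\mathbb S^n$, and suppose that $\overline X$ and all $\widetilde X_m$ are positive semidefinite. For $m\ge1$ let $\widehat X_m$ be, in the same sense, an optimal solution of $$\min_{X\in\mathbb S^n}\ \frac1{2m}\sum_{i=1}^m\big(y_i-\langle\Theta_{\omega_i},X\rangle\big)^2+\rho_m\Big(\langle I-F(\widetilde X_m),X\rangle+\frac{\gamma_m}2\|X-\widetilde X_m\|_F^2\Big)\quad\text{s.t. }\langle\Theta_k,X\rangle=\langle\Theta_k,\overline X\rangle\ \ \forall k\in\alpha,\ X\succeq0 .$$ Then $\widehat X_m\to\overline X$ in probability as $m\to\infty$. -/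

import Mathlib

open MeasureTheory ProbabilityTheory Filter Topology
open scoped Matrix ENNReal ComplexOrder Matrix.Norms.Frobenius

noncomputable section

namespace RankCorrection

variable {𝕜 : Type*} [RCLike 𝕜] {n₁ n₂ : ℕ}

/-- The trace inner product `⟨X, Y⟩ = Re (Tr (Xᴴ Y))`.  Its induced norm is the Frobenius norm, which
is the norm `‖·‖` on matrices used throughout. -/
def frobInner (X Y : Matrix (Fin n₁) (Fin n₂) 𝕜) : ℝ := RCLike.re (Xᴴ * Y).trace

/-- The real linear space of symmetric (`𝕜 = ℝ`) or Hermitian (`𝕜 = ℂ`) `n × n` matrices. -/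
def hermitianSpace (𝕜 : Type*) [RCLike 𝕜] (n : ℕ) : Submodule ℝ (Matrix (Fin n) (Fin n) 𝕜) :=
  selfAdjoint.submodule ℝ (Matrix (Fin n) (Fin n) 𝕜)

/-- The real linear spaces under consideration: all real or complex `n₁ × n₂` matrices, or the
symmetric, respectively Hermitian, `n × n` matrices. -/
inductive IsMatrixSpace (𝕜 : Type*) [RCLike 𝕜] :
    ∀ n₁ n₂ : ℕ, Submodule ℝ (Matrix (Fin n₁) (Fin n₂) 𝕜) → Prop
  | rectangular (n₁ n₂ : ℕ) : IsMatrixSpace 𝕜 n₁ n₂ ⊤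
  | hermitian (n : ℕ) : IsMatrixSpace 𝕜 n n (hermitianSpace 𝕜 n)

/-- The singular value vector of `X`, in nonincreasing order. -/
def singularVec (X : Matrix (Fin n₁) (Fin n₂) 𝕜) : Fin (min n₁ n₂) → ℝ :=
  fun i => (Matrix.toEuclideanLin X).singularValues i

/-- The nuclear norm: the sum of the singular values. -/
def nuclearNorm (X : Matrix (Fin n₁) (Fin n₂) 𝕜) : ℝ := ∑ i, singularVec X i

/-- The rectangular `n₁ × n₂` diagonal matrix with diagonal `x`. -/
def rectDiag (𝕜 : Type*) [RCLike 𝕜] {n₁ n₂ : ℕ} (x : Fin (min n₁ n₂) → ℝ) :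
    Matrix (Fin n₁) (Fin n₂) 𝕜 :=
  Matrix.of fun i j =>
    if h : i.val = j.val then ((x ⟨i.val, lt_min i.isLt (h ▸ j.isLt)⟩ : ℝ) : 𝕜) else 0

/-- The pairs `(U, W)` of orthogonal (unitary) matrices with `X = U Diag(σ(X)) Wᴴ`. -/
def svdPairs (X : Matrix (Fin n₁) (Fin n₂) 𝕜) :
    Set (Matrix (Fin n₁) (Fin n₁) 𝕜 × Matrix (Fin n₂) (Fin n₂) 𝕜) :=
  {P | P.1 ∈ Matrix.unitaryGroup (Fin n₁) 𝕜 ∧ P.2 ∈ Matrix.unitaryGroup (Fin n₂) 𝕜 ∧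
    X = P.1 * rectDiag 𝕜 (singularVec X) * P.2ᴴ}

/-- `f : ℝⁿ → ℝⁿ` is symmetric: `f (Q x) = Q (f x)` for every signed permutation matrix `Q`, where
`(Q x) i = ε i * x (π i)` with signs `ε` and a permutation `π`. -/
def IsSymmetricMap {n : ℕ} (f : (Fin n → ℝ) → (Fin n → ℝ)) : Prop :=
  ∀ (π : Equiv.Perm (Fin n)) (ε : Fin n → ℝ), (∀ i, ε i = 1 ∨ ε i = -1) →
    ∀ x : Fin n → ℝ, f (fun i => ε i * x (π i)) = fun i => ε i * f x (π i)

open scoped Classical in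
/-- The spectral operator associated with `f`: `F(X) = U Diag(f(σ(X))) Wᴴ` for `(U, W)` in
`svdPairs X`.  Every matrix has a singular value decomposition, and for symmetric `f` the value does
not depend on the pair chosen. -/
def spectralOperator (f : (Fin (min n₁ n₂) → ℝ) → (Fin (min n₁ n₂) → ℝ))
    (X : Matrix (Fin n₁) (Fin n₂) 𝕜) : Matrix (Fin n₁) (Fin n₂) 𝕜 :=
  if h : (svdPairs X).Nonempty then
    h.some.1 * rectDiag 𝕜 (f (singularVec X)) * h.some.2ᴴ
  else 0

/-- `x_m = O_p(1)`: the sequence of real random variables is bounded in probability. -/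
def BoundedInProbability {S : Type*} [MeasurableSpace S] (μ : Measure S) (x : ℕ → S → ℝ) : Prop :=
  ∀ ε : ℝ≥0∞, 0 < ε → ∃ C : ℝ, ∀ᶠ m in atTop, μ {s | C < |x m s|} ≤ ε

/-- The observation model in a real matrix space `V`, on a probability space `(S, μ)`.
The `i`-th observation is `y_i = ⟨Θ (ω i), truth⟩ + ν * ξ i`, for `i = 0, 1, 2, …`. -/
structure ObservationModel {S : Type*} [MeasurableSpace S] (μ : Measure S)
    (V : Submodule ℝ (Matrix (Fin n₁) (Fin n₂) 𝕜)) where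
  /-- the number of basis elements -/
  d : ℕ
  /-- the orthonormal basis of `V` -/
  Θ : Fin d → Matrix (Fin n₁) (Fin n₂) 𝕜
  Θ_orthonormal : ∀ j k, frobInner (Θ j) (Θ k) = if j = k then 1 else 0
  Θ_span : Submodule.span ℝ (Set.range Θ) = V
  /-- the true matrix -/
  truth : Matrix (Fin n₁) (Fin n₂) 𝕜
  truth_mem : truth ∈ V
  /-- the indices of the fixed basis coefficients -/
  α : Finset (Fin d)
  /-- the sampling probabilities -/
  p : Fin d → ℝ
  p_fixed : ∀ k ∈ α, p k = 0
  p_free : ∀ k, k ∉ α → 0 < p k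
  /-- the sampled indices -/
  ω : ℕ → S → Fin d
  ω_measurable : ∀ i, Measurable (ω i)
  ω_indep : iIndepFun ω μ
  ω_law : ∀ i k, μ.real {s | ω i s = k} = p k
  /-- the noise magnitude -/
  ν : ℝ
  ν_pos : 0 < ν
  /-- the noise variables -/
  ξ : ℕ → S → ℝ
  ξ_measurable : ∀ i, Measurable (ξ i)
  ξ_indep : iIndepFun ξ μ
  ξ_identDistrib : ∀ i, IdentDistrib (ξ i) (ξ 0) μ μ
  ξ_memLp : ∀ i, MemLp (ξ i) 2 μ
  ξ_mean : ∀ i, ∫ s, ξ i s ∂μ = 0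
  ξ_variance : ∀ i, ∫ s, (ξ i s) ^ 2 ∂μ = 1
  /-- the sampling of the indices is independent of the noise -/
  ω_ξ_indep : IndepFun (fun s i => ω i s) (fun s i => ξ i s) μ

namespace ObservationModel

variable {S : Type*} [MeasurableSpace S] {μ : Measure S}
  {V : Submodule ℝ (Matrix (Fin n₁) (Fin n₂) 𝕜)}

/-- The observations. -/
def y (M : ObservationModel μ V) (i : ℕ) (s : S) : ℝ :=
  frobInner (M.Θ (M.ω i s)) M.truth + M.ν * M.ξ i s

/-- The least squares loss `(1 / 2m) ‖y - R_Ω(X)‖₂²` of the first `m` observations. -/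
def loss (M : ObservationModel μ V) (m : ℕ) (s : S) (X : Matrix (Fin n₁) (Fin n₂) 𝕜) : ℝ :=
  1 / (2 * (m : ℝ)) * ∑ i ∈ Finset.range m, (M.y i s - frobInner (M.Θ (M.ω i s)) X) ^ 2

/-- The matrices of `V` with the prescribed fixed basis coefficients. -/
def feasible (M : ObservationModel μ V) : Set (Matrix (Fin n₁) (Fin n₂) 𝕜) :=
  {X | X ∈ V ∧ ∀ k ∈ M.α, frobInner (M.Θ k) X = frobInner (M.Θ k) M.truth}

/-- The rank-correction objective with parameters `ρ`, `γ`, spectral operator `F` of `f` and initial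
estimate `Xt`. -/
def objective (M : ObservationModel μ V) (f : (Fin (min n₁ n₂) → ℝ) → (Fin (min n₁ n₂) → ℝ))
    (m : ℕ) (s : S) (ρ γ : ℝ) (Xt X : Matrix (Fin n₁) (Fin n₂) 𝕜) : ℝ :=
  M.loss m s X +
    ρ * (nuclearNorm X - frobInner (spectralOperator f Xt) X + γ / 2 * ‖X - Xt‖ ^ 2)

/-- `X` is an optimal solution of the rank-correction problem. -/
def IsOptimal (M : ObservationModel μ V) (f : (Fin (min n₁ n₂) → ℝ) → (Fin (min n₁ n₂) → ℝ))
    (m : ℕ) (s : S) (ρ γ : ℝ) (Xt X : Matrix (Fin n₁) (Fin n₂) 𝕜) : Prop :=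
  X ∈ M.feasible ∧ IsMinOn (M.objective f m s ρ γ Xt) M.feasible X

/-- The rank-correction objective in the positive semidefinite case. -/
def psdObjective {n : ℕ} (M : ObservationModel μ (hermitianSpace 𝕜 n))
    (f : (Fin (min n n) → ℝ) → (Fin (min n n) → ℝ))
    (m : ℕ) (s : S) (ρ γ : ℝ) (Xt X : Matrix (Fin n) (Fin n) 𝕜) : ℝ :=
  M.loss m s X +
    ρ * (frobInner (1 - spectralOperator f Xt) X + γ / 2 * ‖X - Xt‖ ^ 2)

/-- `X` is an optimal solution of the rank-correction problem with the additional constraint that `X`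
is positive semidefinite. -/
def IsPsdOptimal {n : ℕ} (M : ObservationModel μ (hermitianSpace 𝕜 n))
    (f : (Fin (min n n) → ℝ) → (Fin (min n n) → ℝ))
    (m : ℕ) (s : S) (ρ γ : ℝ) (Xt X : Matrix (Fin n) (Fin n) 𝕜) : Prop :=
  X ∈ M.feasible ∩ {Z | Z.PosSemidef} ∧
    IsMinOn (M.psdObjective f m s ρ γ Xt) (M.feasible ∩ {Z | Z.PosSemidef}) X

end ObservationModel

end RankCorrection

end

open RankCorrection

/-! The weight `ρ m` tends to zero, so the penalty is a vanishing perturbation and the quadratic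
loss decides. In the orthonormal basis, the loss at `X` minus the loss at the truth is a quadratic
in the coefficients of `X - truth` (`loss_sub_loss_truth`). Feasibility kills the coefficients in
`α`; on the others the empirical frequencies stay above some `c > 0` and the averaged noise is
small, both by a weak law. On an event of probability close to one, where the estimate is also near
the truth and `γ` is bounded, the loss gap is at least `c / 2 * t ^ 2` up to small terms, with `t =
‖X - truth‖`, and beats the penalty once `t ≥ ε` (`penalizedLoss_truth_lt`). Optimality of `Xhat` is
assumed only where an optimum exists, so existence must be proved on that event too. It follows from
compactness of a ball and lower semicontinuity of the nuclear norm, a consequence of half of von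
Neumann's trace inequality. -/

namespace RankCorrection

/-! ### Singular vectors and the trace inequality -/

section SingularBasis

variable {𝕜 : Type*} [RCLike 𝕜]
  {E : Type*} [NormedAddCommGroup E] [InnerProductSpace 𝕜 E]
  {F : Type*} [NormedAddCommGroup F] [InnerProductSpace 𝕜 F]

/-- Right singular vectors: an orthonormal basis whose images are pairwise orthogonal, with the
singular values as norms. -/
theorem exists_rightSingularBasis [FiniteDimensional 𝕜 E] [FiniteDimensional 𝕜 F]
    (T : E →ₗ[𝕜] F) {n : ℕ} (hn : Module.finrank 𝕜 E = n) :
    ∃ b : OrthonormalBasis (Fin n) 𝕜 E,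
      (∀ i j, i ≠ j → inner 𝕜 (T (b i)) (T (b j)) = 0) ∧ ∀ i, ‖T (b i)‖ = T.singularValues i := by
  set b := T.isSymmetric_adjoint_comp_self.eigenvectorBasis hn
  have key : ∀ i j, inner 𝕜 (T (b i)) (T (b j)) =
      (T.isSymmetric_adjoint_comp_self.eigenvalues hn j : 𝕜) * inner 𝕜 (b i) (b j) := by
    intro i j
    rw [← LinearMap.adjoint_inner_right, ← LinearMap.comp_apply,
      T.isSymmetric_adjoint_comp_self.apply_eigenvectorBasis hn j, inner_smul_right]
  refine ⟨b, fun i j hij => ?_, fun i => ?_⟩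
  · rw [key, b.orthonormal.2 hij, mul_zero]
  · have h := key i i
    rw [inner_self_eq_norm_sq_to_K, inner_self_eq_norm_sq_to_K, b.orthonormal.1 i] at h
    have h' : ‖T (b i)‖ ^ 2 = T.isSymmetric_adjoint_comp_self.eigenvalues hn i := by
      exact_mod_cast (by simpa using h :
        ((‖T (b i)‖ : 𝕜)) ^ 2 = (T.isSymmetric_adjoint_comp_self.eigenvalues hn i : 𝕜))
    rw [T.singularValues_fin hn i, ← h', Real.sqrt_sq (norm_nonneg _)]

theorem norm_sum_smul_sq_le {ι : Type*} [Fintype ι] (u : ι → F)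
    (hu : ∀ i j, i ≠ j → inner 𝕜 (u i) (u j) = 0) (hu1 : ∀ i, ‖u i‖ ≤ 1) (a : ι → 𝕜) :
    ‖∑ i, a i • u i‖ ^ 2 ≤ ∑ i, ‖a i‖ ^ 2 := by
  classical
  have h : inner 𝕜 (∑ i, a i • u i) (∑ i, a i • u i) = ((∑ i, ‖a i‖ ^ 2 * ‖u i‖ ^ 2 : ℝ) : 𝕜) := by
    simp only [sum_inner, inner_sum, inner_smul_left, inner_smul_right]
    push_cast
    refine Finset.sum_congr rfl fun i _ => ?_
    rw [Finset.sum_eq_single i (fun j _ hj => by simp [hu j i hj]) (by simp),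
      inner_self_eq_norm_sq_to_K, ← mul_assoc, mul_comm (a i), RCLike.conj_mul]
  rw [inner_self_eq_norm_sq_to_K] at h
  have h' : ‖∑ i, a i • u i‖ ^ 2 = ∑ i, ‖a i‖ ^ 2 * ‖u i‖ ^ 2 := by exact_mod_cast h
  rw [h']
  refine Finset.sum_le_sum fun i _ => mul_le_of_le_one_right (by positivity) ?_
  exact pow_le_one₀ (norm_nonneg _) (hu1 i)

/-- Half of von Neumann's trace inequality, with an arbitrary orthonormal basis. -/
theorem sum_re_inner_le_sum_norm {ι κ : Type*} [Fintype ι] [Fintype κ] (T : E →ₗ[𝕜] F)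
    (v : OrthonormalBasis ι 𝕜 E) (w : OrthonormalBasis κ 𝕜 E) (u : ι → F)
    (hu : ∀ i j, i ≠ j → inner 𝕜 (u i) (u j) = 0) (hu1 : ∀ i, ‖u i‖ ≤ 1) :
    ∑ i, RCLike.re (inner 𝕜 (u i) (T (v i))) ≤ ∑ j, ‖T (w j)‖ := by
  -- A change of basis in a trace: the vector paired with `T (w j)` is the image of `w j` under the
  -- contraction taking `v i` to `u i`.
  have h : ∑ i, inner 𝕜 (u i) (T (v i)) =
      ∑ j, inner 𝕜 (∑ i, inner 𝕜 (v i) (w j) • u i) (T (w j)) := by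
    simp only [sum_inner, inner_smul_left, inner_conj_symm]
    rw [Finset.sum_comm]
    refine Finset.sum_congr rfl fun i _ => ?_
    conv_lhs => rw [← w.sum_repr' (v i), map_sum, inner_sum]
    simp [inner_smul_right]
  rw [← map_sum, h, map_sum]
  refine Finset.sum_le_sum fun j _ => (RCLike.re_le_norm _).trans ((norm_inner_le_norm _ _).trans ?_)
  refine mul_le_of_le_one_left (norm_nonneg _) ?_
  have := norm_sum_smul_sq_le u hu hu1 fun i => inner 𝕜 (v i) (w j)
  rw [v.sum_sq_norm_inner_right, w.orthonormal.1 j] at this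
  exact (sq_le_one_iff₀ (norm_nonneg _)).1 (by simpa using this)

end SingularBasis

variable {𝕜 : Type*} [RCLike 𝕜] {n₁ n₂ : ℕ}

/-! ### Lower semicontinuity of the nuclear norm -/

/-- The rank is at most `n₁`, so the added singular values vanish; the sum then matches a full right
singular basis. -/
theorem nuclearNorm_eq_sum (X : Matrix (Fin n₁) (Fin n₂) 𝕜) :
    nuclearNorm X = ∑ i : Fin n₂, (Matrix.toEuclideanLin X).singularValues i := by
  unfold nuclearNorm singularVec
  rw [Finset.sum_range (fun i => (Matrix.toEuclideanLin X).singularValues i) |>.symm,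
    Finset.sum_range (fun i => (Matrix.toEuclideanLin X).singularValues i) |>.symm]
  refine Finset.sum_subset (Finset.range_mono (min_le_right _ _)) fun i hi hi' => ?_
  rw [LinearMap.singularValues_eq_zero_iff_le_finrank_range]
  have h1 := (LinearMap.range (Matrix.toEuclideanLin X)).finrank_le
  rw [finrank_euclideanSpace_fin] at h1
  simp only [Finset.mem_range, lt_min_iff] at hi hi'
  omega

theorem nuclearNorm_nonneg (X : Matrix (Fin n₁) (Fin n₂) 𝕜) : 0 ≤ nuclearNorm X :=
  Finset.sum_nonneg fun _ _ => LinearMap.singularValues_nonneg _ _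

/-- Duality: at each `X₀` a continuous linear functional lies below the nuclear norm everywhere and
agrees with it at `X₀`. -/
theorem lowerSemicontinuous_nuclearNorm :
    LowerSemicontinuous (nuclearNorm : Matrix (Fin n₁) (Fin n₂) 𝕜 → ℝ) := by
  intro X₀ y hy
  obtain ⟨v, hv, hvn⟩ := exists_rightSingularBasis (Matrix.toEuclideanLin X₀)
    (finrank_euclideanSpace_fin (𝕜 := 𝕜) (n := n₂))
  -- Left singular vectors. Since `0⁻¹ = 0`, a null direction gives `u i = 0`, which is why only `‖u
  -- i‖ ≤ 1` is claimed.
  set u : Fin n₂ → EuclideanSpace 𝕜 (Fin n₁) := fun i =>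
    ((‖Matrix.toEuclideanLin X₀ (v i)‖⁻¹ : ℝ) : 𝕜) • Matrix.toEuclideanLin X₀ (v i) with hu_def
  have hu : ∀ i j, i ≠ j → inner 𝕜 (u i) (u j) = 0 := fun i j hij => by
    simp [hu_def, inner_smul_left, inner_smul_right, hv i j hij]
  have hu1 : ∀ i, ‖u i‖ ≤ 1 := fun i => by
    simp only [hu_def, norm_smul, RCLike.norm_ofReal, abs_inv, abs_norm]
    exact inv_mul_le_one
  let φ : Matrix (Fin n₁) (Fin n₂) 𝕜 → ℝ := fun X =>
    ∑ i, RCLike.re (inner 𝕜 (u i) (Matrix.toEuclideanLin X (v i)))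
  have hφ_cont : Continuous φ := by
    refine continuous_finsetSum _ fun i _ => RCLike.continuous_re.comp ?_
    refine Continuous.inner continuous_const ?_
    exact (LinearMap.continuous_of_finiteDimensional
      ((LinearMap.applyₗ (v i)).comp (Matrix.toEuclideanLin (𝕜 := 𝕜) (m := Fin n₁)
        (n := Fin n₂)).toLinearMap))
  have hφ_le : ∀ X, φ X ≤ nuclearNorm X := fun X => by
    obtain ⟨w, -, hw⟩ := exists_rightSingularBasis (Matrix.toEuclideanLin X)
      (finrank_euclideanSpace_fin (𝕜 := 𝕜) (n := n₂))
    rw [nuclearNorm_eq_sum]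
    simp only [← hw]
    exact sum_re_inner_le_sum_norm _ v w u hu hu1
  have hφ_eq : φ X₀ = nuclearNorm X₀ := by
    rw [nuclearNorm_eq_sum]
    refine Finset.sum_congr rfl fun i _ => ?_
    rw [← hvn i]
    simp only [hu_def, inner_smul_left, inner_self_eq_norm_sq_to_K]
    rcases eq_or_ne ‖Matrix.toEuclideanLin X₀ (v i)‖ 0 with h | h
    · simp [h]
    · rw [RCLike.conj_ofReal, ← RCLike.ofReal_pow, ← RCLike.ofReal_mul, RCLike.ofReal_re]
      field_simp
  filter_upwards [hφ_cont.continuousAt.eventually_const_lt (hφ_eq ▸ hy)] with X hX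
  exact hX.trans_le (hφ_le X)


/-! ### The trace inner product -/

theorem frobInner_eq_sum (X Y : Matrix (Fin n₁) (Fin n₂) 𝕜) :
    frobInner X Y = ∑ j, ∑ i, RCLike.re (star (X i j) * Y i j) := by
  simp [frobInner, Matrix.trace, Matrix.mul_apply]

theorem frobInner_comm (X Y : Matrix (Fin n₁) (Fin n₂) 𝕜) : frobInner X Y = frobInner Y X := by
  simp only [frobInner_eq_sum]
  refine Finset.sum_congr rfl fun j _ => Finset.sum_congr rfl fun i _ => ?_
  simp only [RCLike.star_def, RCLike.mul_re, RCLike.conj_re, RCLike.conj_im]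
  ring

/-- The trace inner product with a fixed matrix, as a real linear functional. -/
def frobInnerₗ (X : Matrix (Fin n₁) (Fin n₂) 𝕜) : Matrix (Fin n₁) (Fin n₂) 𝕜 →ₗ[ℝ] ℝ where
  toFun := frobInner X
  map_add' Y Z := by simp [frobInner, Matrix.mul_add]
  map_smul' c Y := by simp [frobInner, RCLike.smul_re]

theorem frobInner_sub_right (X Y Z : Matrix (Fin n₁) (Fin n₂) 𝕜) :
    frobInner X (Y - Z) = frobInner X Y - frobInner X Z := (frobInnerₗ X).map_sub Y Z

theorem frobInner_neg_left (X Y : Matrix (Fin n₁) (Fin n₂) 𝕜) :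
    frobInner (-X) Y = -frobInner X Y := by
  rw [frobInner_comm, frobInner_comm X]
  exact (frobInnerₗ Y).map_neg X

theorem continuous_frobInner (X : Matrix (Fin n₁) (Fin n₂) 𝕜) : Continuous (frobInner X) :=
  (frobInnerₗ X).continuous_of_finiteDimensional

theorem frobenius_norm_sq (X : Matrix (Fin n₁) (Fin n₂) 𝕜) : ‖X‖ ^ 2 = ∑ i, ∑ j, ‖X i j‖ ^ 2 := by
  rw [Matrix.frobenius_norm_def, ← Real.sqrt_eq_rpow, Real.sq_sqrt (by positivity)]
  simp

theorem frobInner_self (X : Matrix (Fin n₁) (Fin n₂) 𝕜) : frobInner X X = ‖X‖ ^ 2 := by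
  rw [frobenius_norm_sq, Finset.sum_comm, frobInner_eq_sum]
  refine Finset.sum_congr rfl fun j _ => Finset.sum_congr rfl fun i _ => ?_
  rw [RCLike.star_def, RCLike.conj_mul, ← RCLike.ofReal_pow, RCLike.ofReal_re]

theorem abs_frobInner_le (X Y : Matrix (Fin n₁) (Fin n₂) 𝕜) : |frobInner X Y| ≤ ‖X‖ * ‖Y‖ := by
  refine abs_le_of_sq_le_sq ?_ (by positivity)
  have h : ∀ t : ℝ, 0 ≤ ‖Y‖ ^ 2 * (t * t) + (2 * frobInner X Y) * t + ‖X‖ ^ 2 := fun t => by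
    have h0 : 0 ≤ frobInner (X + t • Y) (X + t • Y) := by rw [frobInner_self]; positivity
    have e : ∀ Z, frobInner Z (X + t • Y) = frobInner Z X + t * frobInner Z Y := fun Z =>
      ((frobInnerₗ Z).map_add X (t • Y)).trans
        (congrArg (frobInner Z X + ·) ((frobInnerₗ Z).map_smul t Y))
    rw [e, frobInner_comm _ X, frobInner_comm _ Y, e, e, frobInner_comm Y X, frobInner_self,
      frobInner_self] at h0
    linarith
  have := discrim_le_zero h
  rw [discrim] at this
  nlinarith

/-! ### Growth of the objective away from the truth -/

namespace ObservationModel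

variable {S : Type*} [MeasurableSpace S] {μ : Measure S}
  {V : Submodule ℝ (Matrix (Fin n₁) (Fin n₂) 𝕜)}

theorem sum_frobInner_smul (M : ObservationModel μ V) {X : Matrix (Fin n₁) (Fin n₂) 𝕜}
    (hX : X ∈ V) : ∑ k, frobInner (M.Θ k) X • M.Θ k = X := by
  let P : Matrix (Fin n₁) (Fin n₂) 𝕜 →ₗ[ℝ] Matrix (Fin n₁) (Fin n₂) 𝕜 :=
    ∑ k, (frobInnerₗ (M.Θ k)).smulRight (M.Θ k)
  have hP : ∀ Y, P Y = ∑ k, frobInner (M.Θ k) Y • M.Θ k := fun Y => by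
    simp only [P, LinearMap.sum_apply, LinearMap.smulRight_apply]
    rfl
  have h : Set.EqOn P (LinearMap.id : _ →ₗ[ℝ] Matrix (Fin n₁) (Fin n₂) 𝕜)
      (Submodule.span ℝ (Set.range M.Θ)) := by
    refine LinearMap.eqOn_span ?_
    rintro _ ⟨j, rfl⟩
    rw [hP]
    simp [M.Θ_orthonormal]
  rw [← hP]
  exact h (M.Θ_span.ge hX)

theorem sum_frobInner_sq (M : ObservationModel μ V) {X : Matrix (Fin n₁) (Fin n₂) 𝕜}
    (hX : X ∈ V) : ∑ k, frobInner (M.Θ k) X ^ 2 = ‖X‖ ^ 2 := by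
  have h : frobInnerₗ X (∑ k, frobInner (M.Θ k) X • M.Θ k) = ‖X‖ ^ 2 := by
    rw [M.sum_frobInner_smul hX]
    exact frobInner_self X
  rw [← h, map_sum]
  refine Finset.sum_congr rfl fun k _ => ?_
  rw [map_smul, smul_eq_mul, sq]
  exact congrArg _ (frobInner_comm _ _)

theorem norm_Θ (M : ObservationModel μ V) (k : Fin M.d) : ‖M.Θ k‖ = 1 := by
  have h := M.Θ_orthonormal k k
  rw [frobInner_self, if_pos rfl] at h
  exact (pow_eq_one_iff_of_nonneg (norm_nonneg _) two_ne_zero).1 h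

/-- The empirical frequency of the index `k` among the first `m` observations. -/
noncomputable def freq (M : ObservationModel μ V) (m : ℕ) (s : S) (k : Fin M.d) : ℝ :=
  (m : ℝ)⁻¹ * ∑ i ∈ Finset.range m, if M.ω i s = k then 1 else 0

/-- The average of the noise over the first `m` observations, restricted to the index `k`. -/
noncomputable def noise (M : ObservationModel μ V) (m : ℕ) (s : S) (k : Fin M.d) : ℝ :=
  (m : ℝ)⁻¹ * ∑ i ∈ Finset.range m, if M.ω i s = k then M.ξ i s else 0

/-- Each residual is `ν * ξ i` minus a coefficient of `X - truth`; the squared noises cancel, and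
the rest is grouped by sampled index. -/
theorem loss_sub_loss_truth (M : ObservationModel μ V) (m : ℕ) (s : S)
    (X : Matrix (Fin n₁) (Fin n₂) 𝕜) :
    M.loss m s X - M.loss m s M.truth =
      ∑ k, (M.freq m s k * frobInner (M.Θ k) (X - M.truth) ^ 2 / 2 -
        M.ν * (M.noise m s k * frobInner (M.Θ k) (X - M.truth))) := by
  simp only [frobInner_sub_right, freq, noise, loss, y, Finset.mul_sum, Finset.sum_mul,
    Finset.sum_div, ← Finset.sum_sub_distrib]
  rw [Finset.sum_comm]
  refine Finset.sum_congr rfl fun i _ => ?_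
  rw [Finset.sum_eq_single (M.ω i s) (fun k _ hk => by simp [Ne.symm hk]) (by simp)]
  simp only [if_true, one_div, mul_inv]
  ring

theorem le_loss_sub_loss_truth (M : ObservationModel μ V) (m : ℕ) (s : S)
    {X : Matrix (Fin n₁) (Fin n₂) 𝕜} (hX : X ∈ M.feasible) {c η : ℝ}
    (hc : ∀ k, k ∉ M.α → c ≤ M.freq m s k) (hη : ∀ k, |M.noise m s k| ≤ η) :
    c / 2 * ‖X - M.truth‖ ^ 2 - M.ν * η * M.d * ‖X - M.truth‖ ≤
      M.loss m s X - M.loss m s M.truth := by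
  have hsum : ∑ _k : Fin M.d, M.ν * (η * ‖X - M.truth‖) = M.ν * η * M.d * ‖X - M.truth‖ := by
    simp only [Finset.sum_const, Finset.card_univ, Fintype.card_fin, nsmul_eq_mul]
    ring
  rw [M.loss_sub_loss_truth, ← M.sum_frobInner_sq (V.sub_mem hX.1 M.truth_mem), ← hsum,
    Finset.mul_sum, ← Finset.sum_sub_distrib]
  refine Finset.sum_le_sum fun k _ => sub_le_sub ?_ ?_
  · by_cases hk : k ∈ M.α
    · simp [frobInner_sub_right, hX.2 k hk]
    · nlinarith [hc k hk, sq_nonneg (frobInner (M.Θ k) (X - M.truth))]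
  · refine mul_le_mul_of_nonneg_left ?_ M.ν_pos.le
    refine (le_abs_self _).trans ?_
    rw [abs_mul]
    refine mul_le_mul (hη k) ?_ (abs_nonneg _) ((abs_nonneg _).trans (hη k))
    simpa [M.norm_Θ k] using abs_frobInner_le (M.Θ k) (X - M.truth)

theorem continuous_loss (M : ObservationModel μ V) (m : ℕ) (s : S) : Continuous (M.loss m s) :=
  continuous_const.mul (continuous_finsetSum _ fun _ _ =>
    (continuous_const.sub (continuous_frobInner _)).pow 2)

theorem isClosed_feasible (M : ObservationModel μ V) : IsClosed M.feasible := by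
  have : M.feasible = (V : Set (Matrix (Fin n₁) (Fin n₂) 𝕜)) ∩
      ⋂ k ∈ M.α, {X | frobInner (M.Θ k) X = frobInner (M.Θ k) M.truth} := by
    ext X
    simp [feasible]
  rw [this]
  refine V.closed_of_finiteDimensional.inter (isClosed_biInter fun k _ => ?_)
  exact isClosed_eq (continuous_frobInner _) continuous_const

theorem truth_mem_feasible (M : ObservationModel μ V) : M.truth ∈ M.feasible :=
  ⟨M.truth_mem, fun _ _ => rfl⟩

/-- The penalized least squares objective with penalty `g - ⟨G, ·⟩ + γ / 2 * ‖· - Xt‖²`. -/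
noncomputable def penalizedLoss (M : ObservationModel μ V) (g : Matrix (Fin n₁) (Fin n₂) 𝕜 → ℝ)
    (m : ℕ) (s : S)
    (ρ γ : ℝ) (G Xt X : Matrix (Fin n₁) (Fin n₂) 𝕜) : ℝ :=
  M.loss m s X + ρ * (g X - frobInner G X + γ / 2 * ‖X - Xt‖ ^ 2)

theorem lowerSemicontinuous_penalizedLoss (M : ObservationModel μ V)
    {g : Matrix (Fin n₁) (Fin n₂) 𝕜 → ℝ} (hg : LowerSemicontinuous g) (m : ℕ) (s : S)
    {ρ : ℝ} (hρ : 0 < ρ) (γ : ℝ) (G Xt : Matrix (Fin n₁) (Fin n₂) 𝕜) :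
    LowerSemicontinuous (M.penalizedLoss g m s ρ γ G Xt) := by
  have h1 : LowerSemicontinuous fun X => ρ * g X :=
    (continuous_const_mul ρ).comp_lowerSemicontinuous hg (monotone_mul_left_of_nonneg hρ.le)
  have h2 : Continuous fun X => M.loss m s X + ρ * (-frobInner G X + γ / 2 * ‖X - Xt‖ ^ 2) :=
    (M.continuous_loss m s).add (continuous_const.mul ((continuous_frobInner G).neg.add
      (continuous_const.mul ((continuous_id.sub continuous_const).norm.pow 2))))
  have h3 : M.penalizedLoss g m s ρ γ G Xt = fun X => ρ * g X +
      (M.loss m s X + ρ * (-frobInner G X + γ / 2 * ‖X - Xt‖ ^ 2)) := by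
    funext X
    simp only [penalizedLoss]
    ring
  rw [h3]
  exact h1.add h2.lowerSemicontinuous

/-- With `t = ‖X - truth‖ ≥ ε`, the noise, the linear term and the remaining penalty each cost at
most `c * t ^ 2 / 8`, against a gain of `c * t ^ 2 / 2`. -/
theorem penalizedLoss_truth_lt (M : ObservationModel μ V) {g : Matrix (Fin n₁) (Fin n₂) 𝕜 → ℝ}
    (hg : ∀ X, 0 ≤ g X) {m : ℕ} {s : S} {ρ γ : ℝ} {G Xt X : Matrix (Fin n₁) (Fin n₂) 𝕜}
    (hρ : 0 < ρ) (hX : X ∈ M.feasible) {c η B C ε : ℝ} (hc : 0 < c) (hε : 0 < ε)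
    (hfreq : ∀ k, k ∉ M.α → c ≤ M.freq m s k) (hη : ∀ k, |M.noise m s k| ≤ η)
    (hG : ‖G‖ ≤ B) (hγ : 0 ≤ γ) (hγC : γ ≤ C) (hXt : ‖Xt - M.truth‖ ≤ 1)
    (h1 : M.ν * η * M.d ≤ c * ε / 8) (h2 : ρ * B ≤ c * ε / 8)
    (h3 : ρ * (g M.truth + C / 2) ≤ c * ε ^ 2 / 8) (hεX : ε ≤ ‖X - M.truth‖) :
    M.penalizedLoss g m s ρ γ G Xt M.truth < M.penalizedLoss g m s ρ γ G Xt X := by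
  have hl := M.le_loss_sub_loss_truth m s hX hfreq hη
  set t := ‖X - M.truth‖
  have ht : 0 < t := hε.trans_le hεX
  have hGt : frobInner G X - frobInner G M.truth ≤ B * t := by
    rw [← frobInner_sub_right]
    exact (le_abs_self _).trans ((abs_frobInner_le _ _).trans
      (mul_le_mul_of_nonneg_right hG ht.le))
  have hq : γ / 2 * ‖M.truth - Xt‖ ^ 2 ≤ C / 2 := by
    rw [norm_sub_rev]
    have : ‖Xt - M.truth‖ ^ 2 ≤ 1 := pow_le_one₀ (norm_nonneg _) hXt
    nlinarith
  have hq' : 0 ≤ γ / 2 * ‖X - Xt‖ ^ 2 := by positivity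
  have hpen : ρ * (g M.truth - frobInner G M.truth + γ / 2 * ‖M.truth - Xt‖ ^ 2) -
      ρ * (g X - frobInner G X + γ / 2 * ‖X - Xt‖ ^ 2) ≤
      ρ * B * t + ρ * (g M.truth + C / 2) := by
    have := mul_le_mul_of_nonneg_left (show g M.truth - frobInner G M.truth +
      γ / 2 * ‖M.truth - Xt‖ ^ 2 - (g X - frobInner G X + γ / 2 * ‖X - Xt‖ ^ 2) ≤
      B * t + (g M.truth + C / 2) by linarith [hg X]) hρ.le
    linarith
  have e1 : M.ν * η * M.d * t ≤ c * ε / 8 * t := mul_le_mul_of_nonneg_right h1 ht.le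
  have e2 : ρ * B * t ≤ c * ε / 8 * t := mul_le_mul_of_nonneg_right h2 ht.le
  have e3 : c * ε * t ≤ c * t ^ 2 := by
    rw [sq, mul_assoc]
    exact mul_le_mul_of_nonneg_left (mul_le_mul_of_nonneg_right hεX ht.le) hc.le
  have e4 : c * ε ^ 2 ≤ c * t ^ 2 :=
    mul_le_mul_of_nonneg_left (pow_le_pow_left₀ hε.le hεX 2) hc.le
  have e5 : 0 < c * t ^ 2 := by positivity
  simp only [penalizedLoss]
  linarith

end ObservationModel

/-- A lower semicontinuous function exceeding its value at `x₀` outside a ball around `x₀` attains its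
minimum over a closed set, and all minimizers are in the ball. -/
theorem exists_isMinOn_and_forall_norm_lt {E : Type*} [SeminormedAddCommGroup E] [ProperSpace E]
    {h : E → ℝ} (hh : LowerSemicontinuous h) {C : Set E} (hC : IsClosed C) {x₀ : E} (hx₀ : x₀ ∈ C)
    {ε : ℝ} (hε : 0 < ε) (hlt : ∀ x ∈ C, ε ≤ ‖x - x₀‖ → h x₀ < h x) :
    (∃ x ∈ C, IsMinOn h C x) ∧ ∀ x ∈ C, IsMinOn h C x → ‖x - x₀‖ < ε := by
  constructor
  · have hne : (C ∩ Metric.closedBall x₀ ε).Nonempty := ⟨x₀, hx₀, Metric.mem_closedBall_self hε.le⟩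
    obtain ⟨x, hx, hmin⟩ := (hh.lowerSemicontinuousOn _).exists_isMinOn hne
      ((isCompact_closedBall x₀ ε).inter_left hC)
    refine ⟨x, hx.1, fun z hz => ?_⟩
    -- Points outside the ball lose to `x₀`, which lies in it, so the minimum over the ball is
    -- global.
    by_cases hzε : ‖z - x₀‖ ≤ ε
    · exact hmin ⟨hz, mem_closedBall_iff_norm.2 hzε⟩
    · exact (hmin ⟨hx₀, Metric.mem_closedBall_self hε.le⟩ : h x ≤ h x₀).trans
        (hlt z hz (not_le.1 hzε).le).le
  · intro x hx hmin
    by_contra! hxε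
    exact (hlt x hx hxε).not_ge (hmin hx₀)

/-! ### Weak laws for the frequencies and the noise -/

/-- The weak law of large numbers for uncorrelated variables with bounded second moments. -/
theorem tendstoInMeasure_average_of_orthogonal {S : Type*} [MeasurableSpace S] {μ : Measure S}
    [IsProbabilityMeasure μ] {Z : ℕ → S → ℝ} (hZ : ∀ i, MemLp (Z i) 2 μ)
    (horth : ∀ i j, i ≠ j → ∫ s, Z i s * Z j s ∂μ = 0) {K : ℝ}
    (hK : ∀ i, ∫ s, Z i s ^ 2 ∂μ ≤ K) :
    TendstoInMeasure μ (fun (m : ℕ) s => (m : ℝ)⁻¹ * ∑ i ∈ Finset.range m, Z i s) atTop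
      (fun _ => 0) := by
  have hsecond : ∀ m : ℕ, ∫ s, (∑ i ∈ Finset.range m, Z i s) ^ 2 ∂μ ≤ m * K := fun m => by
    have hint : ∀ i j, Integrable (fun s => Z i s * Z j s) μ := fun i j =>
      (hZ i).integrable_mul (hZ j)
    have e : ∀ s, (∑ i ∈ Finset.range m, Z i s) ^ 2 =
        ∑ i ∈ Finset.range m, ∑ j ∈ Finset.range m, Z i s * Z j s := fun s => by
      rw [sq, Finset.sum_mul_sum]
    simp only [e]
    rw [integral_finsetSum _ fun i _ => integrable_finsetSum _ fun j _ => hint i j]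
    calc ∑ i ∈ Finset.range m, ∫ s, ∑ j ∈ Finset.range m, Z i s * Z j s ∂μ
        = ∑ i ∈ Finset.range m, ∫ s, Z i s ^ 2 ∂μ := by
          refine Finset.sum_congr rfl fun i hi => ?_
          rw [integral_finsetSum _ fun j _ => hint i j,
            Finset.sum_eq_single i (fun j _ hj => horth i j (Ne.symm hj)) (fun h => absurd hi h)]
          simp only [sq]
      _ ≤ ∑ _i ∈ Finset.range m, K := Finset.sum_le_sum fun i _ => hK i
      _ = m * K := by simp
  rw [tendstoInMeasure_iff_measureReal_norm]
  intro ε hε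
  have hlim : Tendsto (fun m : ℕ => K / ε ^ 2 * (m : ℝ)⁻¹) atTop (𝓝 0) := by
    simpa using (tendsto_inv_atTop_nhds_zero_nat (𝕜 := ℝ)).const_mul (K / ε ^ 2)
  refine squeeze_zero' (Eventually.of_forall fun m => measureReal_nonneg) ?_ hlim
  filter_upwards [eventually_gt_atTop 0] with m hm
  have hm' : (0 : ℝ) < m := Nat.cast_pos.2 hm
  have hmem : MemLp (fun s => ∑ i ∈ Finset.range m, Z i s) 2 μ :=
    memLp_finsetSum _ fun i _ => hZ i
  -- Chebyshev: orthogonality makes the second moment of the sum at most `m * K`, against a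
  -- threshold of order `m ^ 2`.
  have hch := mul_meas_ge_le_integral_of_nonneg (μ := μ)
    (f := fun s => (∑ i ∈ Finset.range m, Z i s) ^ 2)
    (Eventually.of_forall fun s => sq_nonneg _) hmem.integrable_sq ((m * ε) ^ 2)
  have hset : {s | ε ≤ ‖(m : ℝ)⁻¹ * ∑ i ∈ Finset.range m, Z i s - 0‖} ⊆
      {s | (m * ε) ^ 2 ≤ (∑ i ∈ Finset.range m, Z i s) ^ 2} := fun s hs => by
    simp only [Set.mem_ofPred_eq, sub_zero, norm_mul, norm_inv, Real.norm_eq_abs,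
      Nat.abs_cast] at hs ⊢
    rw [← sq_abs (∑ i ∈ Finset.range m, Z i s)]
    exact pow_le_pow_left₀ (by positivity) ((le_inv_mul_iff₀ hm').1 hs) 2
  calc μ.real {s | ε ≤ ‖(m : ℝ)⁻¹ * ∑ i ∈ Finset.range m, Z i s - 0‖}
      ≤ μ.real {s | (m * ε) ^ 2 ≤ (∑ i ∈ Finset.range m, Z i s) ^ 2} := measureReal_mono hset
    _ ≤ m * K / (m * ε) ^ 2 := by
        rw [le_div_iff₀' (by positivity)]
        exact hch.trans (hsecond m)
    _ = K / ε ^ 2 * (m : ℝ)⁻¹ := by field_simp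

namespace ObservationModel

variable {S : Type*} [MeasurableSpace S] {μ : Measure S}
  {V : Submodule ℝ (Matrix (Fin n₁) (Fin n₂) 𝕜)}

theorem measurable_ite_eq {d : ℕ} (k : Fin d) (a b : ℝ) :
    Measurable fun j : Fin d => if j = k then a else b := Measurable.of_discrete

theorem integral_indicator_ω (M : ObservationModel μ V) (i : ℕ) (k : Fin M.d) :
    ∫ s, (if M.ω i s = k then (1 : ℝ) else 0) ∂μ = M.p k := by
  have hs : MeasurableSet {s | M.ω i s = k} := M.ω_measurable i (measurableSet_singleton k)
  rw [← M.ω_law i k, ← integral_indicator_one hs]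
  exact integral_congr_ae (Eventually.of_forall fun s => by simp [Set.indicator_apply])

theorem memLp_indicator_ω [IsProbabilityMeasure μ] (M : ObservationModel μ V) (i : ℕ)
    (k : Fin M.d) (q : ℝ≥0∞) :
    MemLp (fun s => if M.ω i s = k then (1 : ℝ) else 0) q μ := by
  refine MemLp.of_bound ((measurable_ite_eq k 1 0).comp (M.ω_measurable i)).aestronglyMeasurable 1
    (Eventually.of_forall fun s => ?_)
  split_ifs <;> simp

theorem tendstoInMeasure_freq [IsProbabilityMeasure μ] (M : ObservationModel μ V) (k : Fin M.d) :
    TendstoInMeasure μ (fun m s => M.freq m s k) atTop (fun _ => M.p k) := by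
  have hmem : ∀ i, MemLp (fun s => (if M.ω i s = k then (1 : ℝ) else 0) - M.p k) 2 μ := fun i =>
    (M.memLp_indicator_ω i k 2).sub (memLp_const _)
  have hzero : ∀ i, ∫ s, ((if M.ω i s = k then (1 : ℝ) else 0) - M.p k) ∂μ = 0 := fun i => by
    rw [integral_sub ((M.memLp_indicator_ω i k 1).integrable le_rfl) (integrable_const _),
      M.integral_indicator_ω]
    simp
  have hp0 : 0 ≤ M.p k := M.ω_law 0 k ▸ measureReal_nonneg
  have hp1 : M.p k ≤ 1 := M.ω_law 0 k ▸ measureReal_le_one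
  have h := tendstoInMeasure_average_of_orthogonal hmem (K := 1) (fun i j hij => ?_) fun i => ?_
  · rw [tendstoInMeasure_iff_norm] at h ⊢
    intro ε hε
    refine (h ε hε).congr' ?_
    filter_upwards [eventually_gt_atTop 0] with m hm
    have hm' : (m : ℝ) ≠ 0 := Nat.cast_ne_zero.2 hm.ne'
    congr 1
    ext s
    simp [freq, Finset.sum_sub_distrib, mul_sub, hm']
  · have hind := (M.ω_indep.indepFun hij).comp
      (φ := fun l => (if l = k then (1 : ℝ) else 0) - M.p k)
      (ψ := fun l => (if l = k then (1 : ℝ) else 0) - M.p k)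
      Measurable.of_discrete Measurable.of_discrete
    exact (hind.integral_mul_eq_mul_integral (hmem i).1 (hmem j).1).trans
      (mul_eq_zero_of_left (hzero i) _)
  · calc ∫ s, ((if M.ω i s = k then (1 : ℝ) else 0) - M.p k) ^ 2 ∂μ
        ≤ ∫ _s, (1 : ℝ) ∂μ := by
          refine integral_mono (hmem i).integrable_sq (integrable_const _) fun s => ?_
          dsimp only
          split_ifs <;> nlinarith
      _ = 1 := by simp

theorem tendstoInMeasure_noise [IsProbabilityMeasure μ] (M : ObservationModel μ V) (k : Fin M.d) :
    TendstoInMeasure μ (fun m s => M.noise m s k) atTop (fun _ => 0) := by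
  have hle : ∀ i s, ‖if M.ω i s = k then M.ξ i s else 0‖ ≤ ‖M.ξ i s‖ := fun i s => by
    split_ifs <;> simp
  have hmeas : ∀ i, Measurable fun s => if M.ω i s = k then M.ξ i s else 0 := fun i =>
    Measurable.ite (M.ω_measurable i (measurableSet_singleton k)) (M.ξ_measurable i)
      measurable_const
  have hmem : ∀ i, MemLp (fun s => if M.ω i s = k then M.ξ i s else 0) 2 μ := fun i =>
    (M.ξ_memLp i).mono (hmeas i).aestronglyMeasurable (Eventually.of_forall (hle i))
  refine tendstoInMeasure_average_of_orthogonal hmem (K := 1) (fun i j hij => ?_) fun i => ?_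
  · have hξ : ∫ s, M.ξ i s * M.ξ j s ∂μ = 0 := by
      refine ((M.ξ_indep.indepFun hij).integral_mul_eq_mul_integral
        (M.ξ_memLp i).1 (M.ξ_memLp j).1).trans ?_
      rw [M.ξ_mean i, zero_mul]
    -- The cross term is a function of the indices times `ξ i * ξ j`; independence of the two
    -- sequences factors its mean, and the noise factor has mean zero.
    have hφ : Measurable fun a : ℕ → Fin M.d =>
        (if a i = k then (1 : ℝ) else 0) * (if a j = k then (1 : ℝ) else 0) :=
      ((measurable_ite_eq k 1 0).comp (measurable_pi_apply i)).mul
        ((measurable_ite_eq k 1 0).comp (measurable_pi_apply j))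
    have hψ : Measurable fun b : ℕ → ℝ => b i * b j :=
      (measurable_pi_apply i).mul (measurable_pi_apply j)
    have h := ((M.ω_ξ_indep.comp hφ hψ).integral_mul_eq_mul_integral
      (hφ.comp (measurable_pi_lambda _ M.ω_measurable)).aestronglyMeasurable
      (hψ.comp (measurable_pi_lambda _ M.ξ_measurable)).aestronglyMeasurable).trans
      (mul_eq_zero_of_right _ hξ)
    refine (integral_congr_ae (Eventually.of_forall fun s => ?_)).trans h
    simp only [Pi.mul_apply, Function.comp_apply]
    split_ifs <;> simp
  · rw [← M.ξ_variance i]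
    refine integral_mono (hmem i).integrable_sq (M.ξ_memLp i).integrable_sq fun s => ?_
    exact sq_le_sq.2 (hle i s)

end ObservationModel

/-! ### Consistency of penalized least squares -/

theorem tendsto_measure_iUnion_zero {ι κ S : Type*} [Fintype κ] [MeasurableSpace S]
    {μ : Measure S} {l : Filter ι} {A : ι → κ → Set S}
    (h : ∀ k, Tendsto (fun m => μ (A m k)) l (𝓝 0)) :
    Tendsto (fun m => μ (⋃ k, A m k)) l (𝓝 0) := by
  refine tendsto_of_tendsto_of_tendsto_of_le_of_le tendsto_const_nhds ?_ (fun _ => zero_le)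
    fun m => measure_iUnion_fintype_le μ _
  simpa using tendsto_finsetSum Finset.univ fun k _ => h k

theorem tendsto_measure_union_zero {ι S : Type*} [MeasurableSpace S]
    {μ : Measure S} {l : Filter ι} {A B : ι → Set S} (hA : Tendsto (fun m => μ (A m)) l (𝓝 0))
    (hB : Tendsto (fun m => μ (B m)) l (𝓝 0)) : Tendsto (fun m => μ (A m ∪ B m)) l (𝓝 0) := by
  refine tendsto_of_tendsto_of_tendsto_of_le_of_le tendsto_const_nhds ?_ (fun _ => zero_le)
    fun m => measure_union_le _ _
  simpa using hA.add hB

theorem isClosed_posSemidef (𝕜 : Type*) [RCLike 𝕜] (n : ℕ) :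
    IsClosed {Z : Matrix (Fin n) (Fin n) 𝕜 | Z.PosSemidef} := by
  simp only [Matrix.posSemidef_iff_dotProduct_mulVec, Set.ofPred_and, Set.ofPred_forall]
  refine (isClosed_eq (continuous_id.matrix_conjTranspose) continuous_id).inter
    (isClosed_iInter fun x => isClosed_le continuous_const ?_)
  exact continuous_const.dotProduct (continuous_id.matrix_mulVec continuous_const)

namespace ObservationModel

variable {S : Type*} [MeasurableSpace S] {μ : Measure S}
  {V : Submodule ℝ (Matrix (Fin n₁) (Fin n₂) 𝕜)}

theorem exists_pos_two_mul_le_p (M : ObservationModel μ V) :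
    ∃ c : ℝ, 0 < c ∧ ∀ k, k ∉ M.α → 2 * c ≤ M.p k := by
  classical
  rcases isEmpty_or_nonempty (Fin M.d) with h | h
  · exact ⟨1, one_pos, fun k => h.elim k⟩
  · obtain ⟨k₀, hk₀⟩ := Finite.exists_min fun k => if k ∈ M.α then (1 : ℝ) else M.p k
    refine ⟨(if k₀ ∈ M.α then (1 : ℝ) else M.p k₀) / 2, ?_, fun k hk => ?_⟩
    · split_ifs with h'
      · norm_num
      · exact half_pos (M.p_free k₀ h')
    · have := hk₀ k
      rw [if_neg hk] at this
      linarith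

/-- Consistency of penalized least squares over a closed set of feasible matrices, when the weight of
the penalty tends to zero. -/
theorem tendstoInMeasure_of_isMinOn_penalizedLoss [IsProbabilityMeasure μ]
    (M : ObservationModel μ V) {g : Matrix (Fin n₁) (Fin n₂) 𝕜 → ℝ} (hg0 : ∀ X, 0 ≤ g X)
    (hg : LowerSemicontinuous g) {C : Set (Matrix (Fin n₁) (Fin n₂) 𝕜)} (hC : IsClosed C)
    (hCf : C ⊆ M.feasible) (hCt : M.truth ∈ C)
    {ρ : ℕ → ℝ} (hρ_pos : ∀ m, 0 < ρ m) (hρ : Tendsto ρ atTop (𝓝 0))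
    {γ : ℕ → S → ℝ} (hγ_nonneg : ∀ m s, 0 ≤ γ m s) (hγ : BoundedInProbability μ γ)
    {Φ : Matrix (Fin n₁) (Fin n₂) 𝕜 → Matrix (Fin n₁) (Fin n₂) 𝕜}
    (hΦ : ContinuousWithinAt Φ (V : Set (Matrix (Fin n₁) (Fin n₂) 𝕜)) M.truth)
    {Xt : ℕ → S → Matrix (Fin n₁) (Fin n₂) 𝕜} (hXtV : ∀ m s, Xt m s ∈ V)
    (hXt : TendstoInMeasure μ Xt atTop (fun _ => M.truth))
    {Xhat : ℕ → S → Matrix (Fin n₁) (Fin n₂) 𝕜}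
    (hXhat : ∀ m, 1 ≤ m → ∀ᵐ s ∂μ,
      (∃ X ∈ C, IsMinOn (M.penalizedLoss g m s (ρ m) (γ m s) (Φ (Xt m s)) (Xt m s)) C X) →
      Xhat m s ∈ C ∧
        IsMinOn (M.penalizedLoss g m s (ρ m) (γ m s) (Φ (Xt m s)) (Xt m s)) C (Xhat m s)) :
    TendstoInMeasure μ Xhat atTop (fun _ => M.truth) := by
  obtain ⟨c, hc, hcp⟩ := M.exists_pos_two_mul_le_p
  -- Continuity of `Φ` enters only through this local bound.
  obtain ⟨r, hr, hΦr⟩ : ∃ r > 0, ∀ X ∈ V, ‖X - M.truth‖ < r → ‖Φ X‖ < ‖Φ M.truth‖ + 1 := by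
    have h := hΦ.norm.eventually_lt_const (lt_add_one ‖Φ M.truth‖)
    obtain ⟨r, hr, h⟩ := Metric.mem_nhdsWithin_iff.1 h
    exact ⟨r, hr, fun X hX hXr => h ⟨mem_ball_iff_norm.2 hXr, hX⟩⟩
  set B := ‖Φ M.truth‖ + 1
  rw [tendstoInMeasure_iff_norm] at hXt ⊢
  intro ε hε
  obtain ⟨η, hη, hηε⟩ : ∃ η : ℝ, 0 < η ∧ M.ν * η * M.d ≤ c * ε / 8 := by
    have hν := M.ν_pos
    -- The `+ 1` guards against `d = 0`.
    refine ⟨c * ε / (8 * M.ν * (M.d + 1)), by positivity, ?_⟩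
    rw [mul_div_assoc', div_mul_eq_mul_div, div_le_div_iff₀ (by positivity) (by norm_num)]
    have : 0 ≤ M.ν * c * ε := by positivity
    nlinarith
  have hbad := tendsto_measure_union_zero
    (tendsto_measure_union_zero
      (tendsto_measure_iUnion_zero fun k =>
        tendstoInMeasure_iff_norm.1 (M.tendstoInMeasure_freq k) c hc)
      (tendsto_measure_iUnion_zero fun k =>
        tendstoInMeasure_iff_norm.1 (M.tendstoInMeasure_noise k) η hη))
    (hXt (min r 1) (lt_min hr one_pos))
  rw [ENNReal.tendsto_nhds_zero]
  intro δ hδ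
  obtain ⟨K, hK⟩ := hγ (δ / 2) (ENNReal.half_pos hδ.ne')
  have hρB : ∀ᶠ m in atTop, ρ m * B ≤ c * ε / 8 := by
    have h : Tendsto (fun m => ρ m * B) atTop (𝓝 0) := by simpa using hρ.mul_const B
    exact (h.eventually_lt_const (by positivity)).mono fun _ h => h.le
  have hρK : ∀ᶠ m in atTop, ρ m * (g M.truth + K / 2) ≤ c * ε ^ 2 / 8 := by
    have h : Tendsto (fun m => ρ m * (g M.truth + K / 2)) atTop (𝓝 0) := by
      simpa using hρ.mul_const (g M.truth + K / 2)
    exact (h.eventually_lt_const (by positivity)).mono fun _ h => h.le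
  filter_upwards [hK, hρB, hρK, eventually_ge_atTop 1,
    ENNReal.tendsto_nhds_zero.1 hbad (δ / 2) (ENNReal.half_pos hδ.ne')] with m hKm hBm hρm hm hbadm
  rw [← ENNReal.add_halves δ]
  -- Only monotonicity and subadditivity of `μ` are used, so these sets need not be measurable.
  refine le_trans (measure_mono_ae ?_) ((measure_union_le _ _).trans (add_le_add hbadm hKm))
  filter_upwards [hXhat m hm] with s hs hsε
  by_contra hgood
  change s ∉ (_ ∪ _ : Set S) at hgood
  simp only [Set.mem_union, Set.mem_iUnion, Set.mem_ofPred_eq, not_or, not_exists, not_le,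
    not_lt, sub_zero, lt_min_iff, Real.norm_eq_abs] at hgood
  obtain ⟨⟨⟨hfreq, hnoise⟩, hXr, hX1⟩, hγK⟩ := hgood
  obtain ⟨hex, hball⟩ := exists_isMinOn_and_forall_norm_lt
    (M.lowerSemicontinuous_penalizedLoss hg m s (hρ_pos m) (γ m s) (Φ (Xt m s)) (Xt m s)) hC hCt hε
    fun X hX hεX => M.penalizedLoss_truth_lt hg0 (hρ_pos m) (hCf hX) hc hε
      (fun k hk => by linarith [hcp k hk, (abs_lt.1 (hfreq k)).1]) (fun k => (hnoise k).le)
      (hΦr _ (hXtV m s) hXr).le (hγ_nonneg m s) ((le_abs_self _).trans hγK) hX1.le hηε hBm hρm hεX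
  obtain ⟨hmem, hmin⟩ := hs hex
  exact (hball _ hmem hmin).not_ge hsε

end ObservationModel

end RankCorrection

theorem theorem4p0 {𝕜 : Type*} [RCLike 𝕜] {S : Type*} [MeasurableSpace S] (μ : Measure S)
    [IsProbabilityMeasure μ]
    (ρ : ℕ → ℝ) (hρ_pos : ∀ m, 0 < ρ m) (hρ : Tendsto ρ atTop (𝓝 0))
    (γ : ℕ → S → ℝ) (hγ_nonneg : ∀ m s, 0 ≤ γ m s) (hγ : BoundedInProbability μ γ) :
    -- the general case
    (∀ (n₁ n₂ : ℕ) (V : Submodule ℝ (Matrix (Fin n₁) (Fin n₂) 𝕜)), IsMatrixSpace 𝕜 n₁ n₂ V →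
      ∀ (M : ObservationModel μ V)
        (f : (Fin (min n₁ n₂) → ℝ) → (Fin (min n₁ n₂) → ℝ)), IsSymmetricMap f →
      ContinuousWithinAt (spectralOperator (𝕜 := 𝕜) f) (V : Set (Matrix (Fin n₁) (Fin n₂) 𝕜))
        M.truth →
      ∀ Xt : ℕ → S → Matrix (Fin n₁) (Fin n₂) 𝕜, (∀ m s, Xt m s ∈ V) →
      TendstoInMeasure μ Xt atTop (fun _ => M.truth) →
      ∀ Xhat : ℕ → S → Matrix (Fin n₁) (Fin n₂) 𝕜,
      (∀ m, 1 ≤ m → ∀ᵐ s ∂μ, (∃ X, M.IsOptimal f m s (ρ m) (γ m s) (Xt m s) X) →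
        M.IsOptimal f m s (ρ m) (γ m s) (Xt m s) (Xhat m s)) →
      TendstoInMeasure μ Xhat atTop (fun _ => M.truth)) ∧
    -- the positive semidefinite case
    (∀ (n : ℕ) (M : ObservationModel μ (hermitianSpace 𝕜 n)), M.truth.PosSemidef →
      ∀ f : (Fin (min n n) → ℝ) → (Fin (min n n) → ℝ), IsSymmetricMap f →
      ContinuousWithinAt (spectralOperator (𝕜 := 𝕜) f)
        (hermitianSpace 𝕜 n : Set (Matrix (Fin n) (Fin n) 𝕜)) M.truth →
      ∀ Xt : ℕ → S → Matrix (Fin n) (Fin n) 𝕜, (∀ m s, (Xt m s).PosSemidef) →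
      TendstoInMeasure μ Xt atTop (fun _ => M.truth) →
      ∀ Xhat : ℕ → S → Matrix (Fin n) (Fin n) 𝕜,
      (∀ m, 1 ≤ m → ∀ᵐ s ∂μ, (∃ X, M.IsPsdOptimal f m s (ρ m) (γ m s) (Xt m s) X) →
        M.IsPsdOptimal f m s (ρ m) (γ m s) (Xt m s) (Xhat m s)) →
      TendstoInMeasure μ Xhat atTop (fun _ => M.truth)) := by
  refine ⟨fun n₁ n₂ V _ M f _ hF Xt hXtV hXt Xhat hXhat => ?_,
    fun n M hpsd f _ hF Xt hXtpsd hXt Xhat hXhat => ?_⟩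
  · exact M.tendstoInMeasure_of_isMinOn_penalizedLoss nuclearNorm_nonneg
      lowerSemicontinuous_nuclearNorm M.isClosed_feasible subset_rfl M.truth_mem_feasible
      hρ_pos hρ hγ_nonneg hγ hF hXtV hXt hXhat
  -- On the semidefinite cone the penalty is linear up to the proximal term: take `g = 0` and `Φ = F
  -- - I`.
  · have hobj : ∀ m s, M.psdObjective f m s (ρ m) (γ m s) (Xt m s) =
        M.penalizedLoss (fun _ => 0) m s (ρ m) (γ m s)
          (-(1 - spectralOperator f (Xt m s))) (Xt m s) := fun m s => by
      funext X
      simp only [ObservationModel.psdObjective, ObservationModel.penalizedLoss,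
        frobInner_neg_left]
      ring
    refine M.tendstoInMeasure_of_isMinOn_penalizedLoss (g := fun _ => 0) (fun _ => le_rfl)
      lowerSemicontinuous_const (M.isClosed_feasible.inter (isClosed_posSemidef 𝕜 n))
      Set.inter_subset_left ⟨M.truth_mem_feasible, hpsd⟩ hρ_pos hρ hγ_nonneg hγ
      (Φ := fun X => -(1 - spectralOperator f X)) (continuousWithinAt_const.sub hF).neg
      (fun m s => (hXtpsd m s).isHermitian) hXt fun m hm => ?_
    filter_upwards [hXhat m hm] with s hs
    simp only [ObservationModel.IsPsdOptimal, hobj] at hs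
    exact hs
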